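/- All vector spaces are real and all operators are linear and bounded. Let $E$ and $F$ be Banach lattices, and let $E^*$, $F^*$ be their (norm) duals; $F^*$ is ordered by $g\le h$ iff $g(y)\le h(y)$ for all $0\le y\in F$. A sequence $(x_n)$ in a Banach lattice is *disjoint* if $|x_m|\wedge|x_n|=0$ for $m\ne n$. A norm-bounded subset $A$ of $E$ is *limited* if $\sup_{a\in A}|f_n(a)|\to 0$ for every weak$^*$-null sequence $(f_n)$ in $E^*$. A norm-bounded subset $A$ of $F$ is an *Lwc set* if every disjoint sequence in its solid hull $\bigcup_{a\in A}[-|a|,|a|]$ converges to $0$ in norm. An operator $T:E\to F$ belongs to * $\mathrm{aLwc}(E,F)$ if $T$ maps relatively weakly compact subsets of $E$ onto Lwc subsets of $F$; * $\mathrm{oLwc}(E,F)$ if $T$ maps order bounded subsets of $E$ onto Lwc subsets of $F$; * $l\text{-}\mathrm{Lwc}(E,F)$ if $T$ maps limited subsets of $E$ onto Lwc subsets of $F$; * $\mathrm{aMwc}(E,F)$ if $f_n(Tx_n)\to 0$ for every weakly convergent sequence $(f_n)$ in $F^*$ and every disjoint norm-bounded sequence $(x_n)$ in $E$; * $\mathrm{oMwc}(E,F)$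 if $f_n(Tx_n)\to 0$ for every order bounded sequence $(f_n)$ in $F^*$ and every disjoint norm-bounded sequence $(x_n)$ in $E$; * $l\text{-}\mathrm{Mwc}(E,F)$ if $Tx_n\to 0$ weakly for every disjoint norm-bounded sequence $(x_n)$ in $E$. For each of these classes the subscript $+$ denotes its subset of positive operators, that is, of those $T$ with $Tx\ge 0$ for all $0\le x\in E$. **Proposition.** The following inclusions hold. 1. $\mathrm{aLwc}_+(E,F)\subseteq \mathrm{oLwc}_+(E,F)=l\text{-}\mathrm{Lwc}_+(E,F)$. 2. $\mathrm{aMwc}_+(E,F)\subseteq \mathrm{oMwc}_+(E,F)\subseteq l\text{-}\mathrm{Mwc}_+(E,F)$. -/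

import Mathlib

open Filter Topology

namespace BanachLattice

/-- A sequence in a vector lattice is disjoint if its terms are pairwise disjoint,
`|xₘ| ∧ |xₙ| = 0` for `m ≠ n`. -/
def DisjointSeq {E : Type*} [AddCommGroup E] [Lattice E] (x : ℕ → E) : Prop :=
  ∀ m n, m ≠ n → |x m| ⊓ |x n| = 0

/-- A subset of an ordered space is order bounded if it lies in an order interval `[a, b]`. -/
def OrderBdd {E : Type*} [Preorder E] (A : Set E) : Prop :=
  ∃ a b : E, A ⊆ Set.Icc a b

/-- A sequence of bounded functionals on `F` is order bounded in the dual `F*`, which is ordered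
by `g ≤ h` iff `g y ≤ h y` for all `y ≥ 0`. -/
def DualOrderBddSeq {F : Type*} [NormedAddCommGroup F] [NormedSpace ℝ F] [Lattice F]
    (f : ℕ → StrongDual ℝ F) : Prop :=
  ∃ g h : StrongDual ℝ F, ∀ n, ∀ y : F, 0 ≤ y → g y ≤ f n y ∧ f n y ≤ h y

/-- A subset is relatively weakly compact if its closure in the weak topology is weakly compact. -/
def RelWeaklyCompact {X : Type*} [NormedAddCommGroup X] [NormedSpace ℝ X] (A : Set X) : Prop :=
  IsCompact (closure (toWeakSpace ℝ X '' A))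

/-- A bounded set is limited if each weak* null sequence in the dual is uniformly null on it. -/
def Limited {X : Type*} [NormedAddCommGroup X] [NormedSpace ℝ X] (A : Set X) : Prop :=
  Bornology.IsBounded A ∧
    ∀ f : ℕ → StrongDual ℝ X,
      Tendsto (fun n => StrongDual.toWeakDual (f n)) atTop (𝓝 0) →
        TendstoUniformlyOn (fun n x => f n x) (fun _ => (0 : ℝ)) atTop A

/-- A bounded set `A` is an Lwc set if each disjoint sequence in its solid hull
`{y | ∃ a ∈ A, |y| ≤ |a|}` is norm null. -/
def LwcSet {F : Type*} [NormedAddCommGroup F] [Lattice F] (A : Set F) : Prop :=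
  Bornology.IsBounded A ∧
    ∀ y : ℕ → F, DisjointSeq y →
      (∀ n, y n ∈ LatticeOrderedAddCommGroup.solidClosure A) →
        Tendsto (fun n => ‖y n‖) atTop (𝓝 0)

/-- Almost L-weakly compact operators. -/
def aLwc (X F : Type*) [NormedAddCommGroup X] [NormedSpace ℝ X]
    [NormedAddCommGroup F] [NormedSpace ℝ F] [Lattice F] : Set (X →L[ℝ] F) :=
  {T | ∀ A : Set X, RelWeaklyCompact A → LwcSet (T '' A)}

/-- Limitedly L-weakly compact operators. -/
def lLwc (X F : Type*) [NormedAddCommGroup X] [NormedSpace ℝ X]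
    [NormedAddCommGroup F] [NormedSpace ℝ F] [Lattice F] : Set (X →L[ℝ] F) :=
  {T | ∀ A : Set X, Limited A → LwcSet (T '' A)}

/-- Order L-weakly compact operators. -/
def oLwc (E F : Type*) [NormedAddCommGroup E] [NormedSpace ℝ E] [Lattice E]
    [NormedAddCommGroup F] [NormedSpace ℝ F] [Lattice F] : Set (E →L[ℝ] F) :=
  {T | ∀ A : Set E, OrderBdd A → LwcSet (T '' A)}

/-- Almost M-weakly compact operators. -/
def aMwc (E Y : Type*) [NormedAddCommGroup E] [NormedSpace ℝ E] [Lattice E]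
    [NormedAddCommGroup Y] [NormedSpace ℝ Y] : Set (E →L[ℝ] Y) :=
  {T | ∀ f : ℕ → StrongDual ℝ Y,
    (∃ g : StrongDual ℝ Y,
      Tendsto (fun n => toWeakSpace ℝ (StrongDual ℝ Y) (f n)) atTop
        (𝓝 (toWeakSpace ℝ (StrongDual ℝ Y) g))) →
    ∀ x : ℕ → E, DisjointSeq x → Bornology.IsBounded (Set.range x) →
      Tendsto (fun n => f n (T (x n))) atTop (𝓝 0)}

/-- Order M-weakly compact operators. -/
def oMwc (E F : Type*) [NormedAddCommGroup E] [NormedSpace ℝ E] [Lattice E]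
    [NormedAddCommGroup F] [NormedSpace ℝ F] [Lattice F] : Set (E →L[ℝ] F) :=
  {T | ∀ f : ℕ → StrongDual ℝ F, DualOrderBddSeq f →
    ∀ x : ℕ → E, DisjointSeq x → Bornology.IsBounded (Set.range x) →
      Tendsto (fun n => f n (T (x n))) atTop (𝓝 0)}

/-- Limitedly M-weakly compact operators: `T xₙ → 0` weakly for each disjoint bounded `(xₙ)`. -/
def lMwc (E Y : Type*) [NormedAddCommGroup E] [NormedSpace ℝ E] [Lattice E]
    [NormedAddCommGroup Y] [NormedSpace ℝ Y] : Set (E →L[ℝ] Y) :=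
  {T | ∀ x : ℕ → E, DisjointSeq x → Bornology.IsBounded (Set.range x) →
      Tendsto (fun n => toWeakSpace ℝ Y (T (x n))) atTop (𝓝 0)}

/-- Positive bounded operators. -/
def positiveOps (E F : Type*) [NormedAddCommGroup E] [NormedSpace ℝ E] [Lattice E]
    [NormedAddCommGroup F] [NormedSpace ℝ F] [Lattice F] : Set (E →L[ℝ] F) :=
  {T | ∀ x : E, 0 ≤ x → 0 ≤ T x}

end BanachLattice

namespace BanachLattice

open NNReal

section VectorLattice

variable {F : Type*} [AddCommGroup F] [Lattice F]

/-! For positive T, everything `oLwc` needs is decided on singletons: T maps an order interval into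
the solid hull of one vector. Singletons are relatively weakly compact and limited, so `aLwc` and
`lLwc` both give `oLwc`. The substantial inclusion is `oLwc` in `lLwc`. Given disjoint y_n with
|y_n| ≤ |T a_n| and a_n in a limited set, one wants functionals h_n with h_n(T a_n) ≥ ‖y_n‖ and h_n
∘ T weak* null. Hahn–Banach provides them, dominated by p_n = `bandSeminorm (y n)`: p_n(T a_n) ≥
‖y_n‖, while p_n(w) → 0 whenever {w} is Lwc. Limitedness then forces ‖y_n‖ → 0. For the Mwc classes,
constant sequences of functionals are both weakly convergent and order bounded, and g ≤ f_n ≤ k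
gives |(f_n - g)(T x_n)| ≤ (k - g)(T|x_n|). -/

theorem add_inf_le_of_nonneg [IsOrderedAddMonoid F] {a b c : F} (ha : 0 ≤ a) (hb : 0 ≤ b) (hc : 0 ≤ c) :
    (a + b) ⊓ c ≤ a ⊓ c + b ⊓ c := by
  -- Distributing turns the right side into the infimum of a + b, c + b, a + c and c + c; the last
  -- three dominate c.
  rw [add_inf, inf_add, inf_add]
  refine le_inf (le_inf inf_le_left (inf_le_right.trans ?_))
    (le_inf (inf_le_right.trans ?_) (inf_le_right.trans ?_))
  · exact le_add_of_nonneg_right hb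
  · exact le_add_of_nonneg_left ha
  · exact le_add_of_nonneg_left hc

variable [Module ℝ F] [IsOrderedModule ℝ F]

theorem abs_smul_le_smul_abs {c : ℝ} (hc : 0 ≤ c) (z : F) : |c • z| ≤ c • |z| := by
  refine abs_le'.2 ⟨smul_le_smul_of_nonneg_left (le_abs_self z) hc, ?_⟩
  rw [← smul_neg]
  exact smul_le_smul_of_nonneg_left (neg_le_abs z) hc

theorem le_smul_of_inv_smul_le {c : ℝ} (hc : 0 < c) {a b : F} (h : c⁻¹ • a ≤ b) : a ≤ c • b := by
  simpa [smul_smul, hc.ne'] using smul_le_smul_of_nonneg_left h hc.le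

theorem smul_inf_smul_eq_zero [IsOrderedAddMonoid F] {a b : F} (ha : 0 ≤ a) (hb : 0 ≤ b) (h : a ⊓ b = 0) {k l : ℝ}
    (hk : 0 ≤ k) (hl : 0 ≤ l) : (k • a) ⊓ (l • b) = 0 := by
  -- One divisor bounding both k and l, positive even if both vanish: after dividing, the infimum
  -- lies below a ⊓ b.
  have hM : 0 < k + l + 1 := by positivity
  refine le_antisymm ?_ (le_inf (smul_nonneg hk ha) (smul_nonneg hl hb))
  have key : (k + l + 1)⁻¹ • ((k • a) ⊓ (l • b)) ≤ 0 := by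
    have hs : ∀ {r : ℝ} {v : F}, 0 ≤ v → 0 ≤ r → r ≤ k + l + 1 →
        (k + l + 1)⁻¹ • (r • v) ≤ v := by
      intro r v hv _ hr
      rw [smul_smul]
      refine smul_le_of_le_one_left hv ?_
      rw [inv_mul_le_iff₀ hM]
      linarith
    rw [← h]
    exact le_inf
      ((smul_le_smul_of_nonneg_left inf_le_left (inv_nonneg.2 hM.le)).trans
        (hs ha hk (by linarith)))
      ((smul_le_smul_of_nonneg_left inf_le_right (inv_nonneg.2 hM.le)).trans
        (hs hb hl (by linarith)))
  simpa using le_smul_of_inv_smul_le hM key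

end VectorLattice

section BandSeminorm

variable {F : Type*} [NormedAddCommGroup F] [Lattice F]

theorem norm_mono_of_nonneg [IsOrderedAddMonoid F] [HasSolidNorm F] {a b : F} (ha : 0 ≤ a) (h : a ≤ b) : ‖a‖ ≤ ‖b‖ :=
  norm_le_norm_of_abs_le_abs (by rwa [abs_of_nonneg ha, abs_of_nonneg (ha.trans h)])

variable [NormedSpace ℝ F]

/-- The seminorm `z ↦ sup_{k ≥ 0} ‖|z| ∧ k|y|‖`, which lives on the band generated by `y`. -/
noncomputable def bandSeminorm (y z : F) : ℝ :=
  ⨆ k : ℝ≥0, ‖|z| ⊓ (k : ℝ) • |y|‖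

theorem bandSeminorm_neg (y z : F) : bandSeminorm y (-z) = bandSeminorm y z := by
  simp [bandSeminorm]

variable [IsOrderedAddMonoid F] [IsOrderedModule ℝ F]

theorem abs_inf_smul_abs_nonneg (y z : F) (k : ℝ≥0) : 0 ≤ |z| ⊓ (k : ℝ) • |y| :=
  le_inf (abs_nonneg z) (smul_nonneg k.2 (abs_nonneg y))

variable [HasSolidNorm F]

theorem norm_abs_inf_smul_abs_le (y z : F) (k : ℝ≥0) : ‖|z| ⊓ (k : ℝ) • |y|‖ ≤ ‖z‖ :=
  (norm_mono_of_nonneg (abs_inf_smul_abs_nonneg y z k) inf_le_left).trans_eq (norm_abs_eq_norm z)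

theorem bddAbove_bandSeminorm (y z : F) :
    BddAbove (Set.range fun k : ℝ≥0 => ‖|z| ⊓ (k : ℝ) • |y|‖) :=
  ⟨‖z‖, by rintro _ ⟨k, rfl⟩; exact norm_abs_inf_smul_abs_le y z k⟩

theorem bandSeminorm_le_norm (y z : F) : bandSeminorm y z ≤ ‖z‖ :=
  ciSup_le (norm_abs_inf_smul_abs_le y z)

theorem norm_inf_le_bandSeminorm (y z : F) (k : ℝ≥0) :
    ‖|z| ⊓ (k : ℝ) • |y|‖ ≤ bandSeminorm y z :=
  le_ciSup (bddAbove_bandSeminorm y z) k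

/-- The term k = 1 of the supremum is already ‖y‖. -/
theorem norm_le_bandSeminorm {y z : F} (h : |y| ≤ |z|) : ‖y‖ ≤ bandSeminorm y z := by
  simpa [inf_eq_right.2 h, norm_abs_eq_norm] using norm_inf_le_bandSeminorm y z 1

theorem bandSeminorm_mono (y : F) {z w : F} (h : |z| ≤ |w|) :
    bandSeminorm y z ≤ bandSeminorm y w :=
  ciSup_mono (bddAbove_bandSeminorm y w) fun k =>
    norm_mono_of_nonneg (abs_inf_smul_abs_nonneg y z k) (inf_le_inf_right _ h)

theorem bandSeminorm_add_le (y z w : F) :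
    bandSeminorm y (z + w) ≤ bandSeminorm y z + bandSeminorm y w := by
  refine ciSup_le fun k => ?_
  refine (norm_mono_of_nonneg (abs_inf_smul_abs_nonneg y (z + w) k) ?_).trans
    ((norm_add_le _ _).trans
      (add_le_add (norm_inf_le_bandSeminorm y z k) (norm_inf_le_bandSeminorm y w k)))
  exact (inf_le_inf_right _ (abs_add_le z w)).trans
    (add_inf_le_of_nonneg (abs_nonneg z) (abs_nonneg w) (smul_nonneg k.2 (abs_nonneg y)))

theorem bandSeminorm_smul_le (y z : F) {c : ℝ} (hc : 0 < c) :
    bandSeminorm y (c • z) ≤ c * bandSeminorm y z := by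
  refine ciSup_le fun k => ?_
  have hci : 0 ≤ c⁻¹ := inv_nonneg.2 hc.le
  have h : |c • z| ⊓ (k : ℝ) • |y| ≤
      -- Pulling c out of the infimum rescales k to k/c, still an admissible index of the supremum.
      c • (|z| ⊓ ((⟨c⁻¹, hci⟩ * k : ℝ≥0) : ℝ) • |y|) := by
    refine le_smul_of_inv_smul_le hc (le_inf ?_ ?_)
    · refine (smul_le_smul_of_nonneg_left
        (inf_le_left.trans (abs_smul_le_smul_abs hc.le z)) hci).trans_eq ?_
      simp [smul_smul, hc.ne']
    · refine (smul_le_smul_of_nonneg_left inf_le_right hci).trans_eq ?_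
      rw [smul_smul]
      rfl
  refine (norm_mono_of_nonneg (abs_inf_smul_abs_nonneg y (c • z) k) h).trans ?_
  rw [norm_smul, Real.norm_of_nonneg hc.le]
  exact mul_le_mul_of_nonneg_left (norm_inf_le_bandSeminorm y z _) hc.le

theorem bandSeminorm_smul (y z : F) {c : ℝ} (hc : 0 < c) :
    bandSeminorm y (c • z) = c * bandSeminorm y z := by
  refine le_antisymm (bandSeminorm_smul_le y z hc) ?_
  have h := bandSeminorm_smul_le y (c • z) (inv_pos.2 hc)
  rwa [smul_smul, inv_mul_cancel₀ hc.ne', one_smul, ← div_eq_inv_mul, le_div_iff₀ hc,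
    mul_comm] at h

/-- A functional dominated by the band seminorm of `y` and norming it at `w`. -/
theorem exists_dual_bandSeminorm (y w : F) :
    ∃ h : StrongDual ℝ F, h w = bandSeminorm y w ∧ ∀ z, |h z| ≤ bandSeminorm y z := by
  have h0 : bandSeminorm y 0 = 0 :=
    le_antisymm (by simpa using bandSeminorm_le_norm y (0 : F))
      ((norm_nonneg _).trans (norm_inf_le_bandSeminorm y 0 0))
  have hnn : ∀ z, 0 ≤ bandSeminorm y z := fun z =>
    (norm_nonneg _).trans (norm_inf_le_bandSeminorm y z 0)
  have hw0 : ∀ c : ℝ, c • w = 0 → c • bandSeminorm y w = 0 := by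
    intro c hc
    rcases smul_eq_zero.1 hc with rfl | rfl
    · simp
    · simp [h0]
  obtain ⟨g, hg, hgle⟩ := exists_extension_of_le_sublinear
    (LinearPMap.mkSpanSingleton' w (bandSeminorm y w) hw0) (bandSeminorm y)
    (fun c hc z => bandSeminorm_smul y z hc) (bandSeminorm_add_le y) (by
      rintro ⟨x, hx⟩
      obtain ⟨c, rfl⟩ := Submodule.mem_span_singleton.1 hx
      rw [LinearPMap.mkSpanSingleton'_apply]
      change c • bandSeminorm y w ≤ bandSeminorm y (c • w)
      rcases lt_or_ge 0 c with hc | hc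
      · rw [bandSeminorm_smul y w hc, smul_eq_mul]
      · exact (mul_nonpos_of_nonpos_of_nonneg hc (hnn w)).trans (hnn _))
  have habs : ∀ z, |g z| ≤ bandSeminorm y z := fun z =>
    abs_le'.2 ⟨hgle z, by simpa [bandSeminorm_neg] using hgle (-z)⟩
  refine ⟨g.mkContinuous 1 fun z => ?_, ?_, habs⟩
  · rw [one_mul, Real.norm_eq_abs]
    exact (habs z).trans (bandSeminorm_le_norm y z)
  · have hmem : w ∈ Submodule.span ℝ {w} := Submodule.mem_span_singleton_self w
    have h1 := hg ⟨w, hmem⟩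
    exact h1.trans (LinearPMap.mkSpanSingleton'_apply_self (R := ℝ) w (bandSeminorm y w) hw0 hmem)

/-- If `{w}` is an Lwc set, the band seminorms of a disjoint sequence tend to zero at `w`. -/
theorem LwcSet.tendsto_bandSeminorm {w : F} (hw : LwcSet ({w} : Set F)) {y : ℕ → F}
    (hy : DisjointSeq y) : Tendsto (fun n => bandSeminorm (y n) w) atTop (𝓝 0) := by
  -- Near-maximal truncations |w| ⊓ k_n|y_n| inherit disjointness from y and lie in the solid hull
  -- of {w}, so the Lwc property applies to them.
  have hk : ∀ n : ℕ, ∃ k : ℝ≥0,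
      bandSeminorm (y n) w - 1 / ((n : ℝ) + 1) < ‖|w| ⊓ (k : ℝ) • |y n|‖ := fun n =>
    exists_lt_of_lt_ciSup (sub_lt_self _ Nat.one_div_pos_of_nat)
  choose k hk using hk
  have hdisj : DisjointSeq fun n => |w| ⊓ (k n : ℝ) • |y n| := by
    intro m n hmn
    dsimp only
    rw [abs_of_nonneg (abs_inf_smul_abs_nonneg _ _ _),
      abs_of_nonneg (abs_inf_smul_abs_nonneg _ _ _)]
    refine le_antisymm ?_
      (le_inf (abs_inf_smul_abs_nonneg _ _ _) (abs_inf_smul_abs_nonneg _ _ _))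
    exact (inf_le_inf inf_le_right inf_le_right).trans_eq
      (smul_inf_smul_eq_zero (abs_nonneg _) (abs_nonneg _) (hy m n hmn) (k m).2 (k n).2)
  have hlim := hw.2 _ hdisj fun n => ⟨w, rfl, by
    rw [abs_of_nonneg (abs_inf_smul_abs_nonneg _ _ _)]; exact inf_le_left⟩
  refine squeeze_zero (fun n => (norm_nonneg _).trans (norm_inf_le_bandSeminorm (y n) w 0))
    (fun n => (sub_lt_iff_lt_add.1 (hk n)).le) ?_
  simpa using hlim.add (tendsto_one_div_add_atTop_nhds_zero_nat (𝕜 := ℝ))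

end BandSeminorm

theorem DisjointSeq.abs {E : Type*} [AddCommGroup E] [Lattice E] [IsOrderedAddMonoid E]
    {x : ℕ → E} (hx : DisjointSeq x) : DisjointSeq fun n => |x n| := by
  intro m n hmn
  simpa using hx m n hmn

section Operators

variable {E : Type*} [NormedAddCommGroup E] [NormedSpace ℝ E]
  {F : Type*} [NormedAddCommGroup F] [NormedSpace ℝ F]

theorem relWeaklyCompact_singleton (u : E) : RelWeaklyCompact ({u} : Set E) := by
  simp [RelWeaklyCompact]

theorem limited_singleton (u : E) : Limited ({u} : Set E) := by
  refine ⟨Bornology.isBounded_singleton, fun f hf => ?_⟩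
  rw [tendstoUniformlyOn_singleton_iff_tendsto]
  exact (WeakDual.eval_continuous u).tendsto _ |>.comp hf

theorem tendsto_toWeakSpace {f : ℕ → E} {x : E}
    (h : ∀ g : StrongDual ℝ E, Tendsto (fun n => g (f n)) atTop (𝓝 (g x))) :
    Tendsto (fun n => toWeakSpace ℝ E (f n)) atTop (𝓝 (toWeakSpace ℝ E x)) := by
  have hind : Topology.IsInducing
      fun (z : WeakSpace ℝ E) (g : StrongDual ℝ E) => (topDualPairing ℝ E).flip z g := ⟨rfl⟩
  exact hind.tendsto_nhds_iff.2 (tendsto_pi_nhds.2 h)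

theorem oMwc_subset_lMwc [Lattice E] [Lattice F] : oMwc E F ⊆ lMwc E F := by
  intro T hT x hx hb
  rw [← map_zero (toWeakSpace ℝ F)]
  refine tendsto_toWeakSpace fun g => ?_
  simpa using hT (fun _ => g) ⟨g, g, fun _ _ _ => ⟨le_rfl, le_rfl⟩⟩ x hx hb

variable [Lattice E] [IsOrderedAddMonoid E] [Lattice F] [IsOrderedAddMonoid F]

theorem abs_apply_le_of_mem_positiveOps {T : E →L[ℝ] F} (hT : T ∈ positiveOps E F) {x u : E}
    (h : |x| ≤ u) : |T x| ≤ T u := by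
  have hx := abs_le'.1 h
  refine abs_le'.2 ⟨?_, ?_⟩
  · simpa using hT (u - x) (sub_nonneg.2 hx.1)
  · simpa [sub_nonneg, neg_le_iff_add_nonneg] using hT (u - -x) (sub_nonneg.2 hx.2)

/-- A positive operator sending singletons to Lwc sets is order L-weakly compact. -/
theorem mem_oLwc_of_singleton [HasSolidNorm F] {T : E →L[ℝ] F} (hT : T ∈ positiveOps E F)
    (h : ∀ u : E, LwcSet ({T u} : Set F)) : T ∈ oLwc E F := by
  rintro A ⟨a, b, hA⟩
  have hle : ∀ x ∈ A, |T x| ≤ |T (|a| ⊔ |b|)| := fun x hx => by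
    refine (abs_apply_le_of_mem_positiveOps hT (abs_le'.2 ⟨?_, ?_⟩)).trans (le_abs_self _)
    · exact (hA hx).2.trans ((le_abs_self b).trans le_sup_right)
    · exact (neg_le_neg (hA hx).1).trans ((neg_le_abs a).trans le_sup_left)
  refine ⟨isBounded_iff_forall_norm_le.2 ⟨‖T (|a| ⊔ |b|)‖, ?_⟩, fun y hy hmem => ?_⟩
  · rintro _ ⟨x, hx, rfl⟩
    exact norm_le_norm_of_abs_le_abs (hle x hx)
  · refine (h (|a| ⊔ |b|)).2 y hy fun n => ?_
    obtain ⟨_, ⟨x, hx, rfl⟩, hyx⟩ := hmem n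
    exact ⟨_, rfl, hyx.trans (hle x hx)⟩

theorem positive_aLwc_subset_oLwc [HasSolidNorm F] :
    aLwc E F ∩ positiveOps E F ⊆ oLwc E F ∩ positiveOps E F := fun T hT =>
  ⟨mem_oLwc_of_singleton hT.2 fun u => by
    simpa using hT.1 {u} (relWeaklyCompact_singleton u), hT.2⟩

theorem positive_lLwc_subset_oLwc [HasSolidNorm F] :
    lLwc E F ∩ positiveOps E F ⊆ oLwc E F ∩ positiveOps E F := fun T hT =>
  ⟨mem_oLwc_of_singleton hT.2 fun u => by simpa using hT.1 {u} (limited_singleton u), hT.2⟩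

theorem positive_oLwc_subset_lLwc [HasSolidNorm F] [IsOrderedModule ℝ F] :
    oLwc E F ∩ positiveOps E F ⊆ lLwc E F ∩ positiveOps E F := by
  rintro T ⟨hT, hpos⟩
  refine ⟨fun A hA => ⟨T.lipschitz.isBounded_image hA.1, fun y hy hmem => ?_⟩, hpos⟩
  have hsing : ∀ u : E, LwcSet ({T u} : Set F) := fun u => by
    simpa using hT {u} ⟨u, u, by simp⟩
  have hex : ∀ n, ∃ a ∈ A, |y n| ≤ |T a| := fun n => by
    obtain ⟨_, ⟨a, ha, rfl⟩, h⟩ := hmem n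
    exact ⟨a, ha, h⟩
  choose a ha hya using hex
  choose h hw hle using fun n => exists_dual_bandSeminorm (y n) (T (a n))
  -- Positivity gives |T x| ≤ T|x|, so at each x the values are dominated by the band seminorms of
  -- the single vector T|x|.
  have hnull : Tendsto (fun n => StrongDual.toWeakDual ((h n).comp T)) atTop (𝓝 0) := by
    rw [tendsto_iff_forall_eval_tendsto_topDualPairing]
    intro x
    refine squeeze_zero_norm (fun n => ?_) ((hsing |x|).tendsto_bandSeminorm hy)
    refine (hle n (T x)).trans (bandSeminorm_mono _ ?_)
    exact (abs_apply_le_of_mem_positiveOps hpos le_rfl).trans (le_abs_self _)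
  have hunif := Metric.tendstoUniformlyOn_iff.1 (hA.2 _ hnull)
  refine Metric.tendsto_atTop.2 fun ε hε => ?_
  obtain ⟨N, hN⟩ := eventually_atTop.1 (hunif ε hε)
  refine ⟨N, fun n hn => ?_⟩
  have h1 := hN n hn (a n) (ha n)
  rw [dist_zero_left] at h1
  rw [dist_zero_right, norm_norm]
  refine lt_of_le_of_lt ?_ h1
  calc ‖y n‖ ≤ bandSeminorm (y n) (T (a n)) := norm_le_bandSeminorm (hya n)
    _ = h n (T (a n)) := (hw n).symm
    _ ≤ ‖((h n).comp T) (a n)‖ := le_abs_self _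

theorem positive_aMwc_subset_oMwc [HasSolidNorm E] :
    aMwc E F ∩ positiveOps E F ⊆ oMwc E F ∩ positiveOps E F := by
  rintro T ⟨hT, hpos⟩
  refine ⟨fun f ⟨g, k, hf⟩ x hx hb => ?_, hpos⟩
  have hbabs : Bornology.IsBounded (Set.range fun n => |x n|) := by
    obtain ⟨C, hC⟩ := isBounded_iff_forall_norm_le.1 hb
    refine isBounded_iff_forall_norm_le.2 ⟨C, ?_⟩
    rintro _ ⟨n, rfl⟩
    exact (norm_abs_eq_norm (x n)).trans_le (hC _ ⟨n, rfl⟩)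
  have hg : Tendsto (fun n => g (T (x n))) atTop (𝓝 0) :=
    hT (fun _ => g) ⟨g, tendsto_const_nhds⟩ x hx hb
  have hk : Tendsto (fun n => (k - g) (T |x n|)) atTop (𝓝 0) :=
    hT (fun _ => k - g) ⟨k - g, tendsto_const_nhds⟩ _ hx.abs hbabs
  -- Since f_n - g is positive and at most k - g on the positive cone, the varying functionals are
  -- controlled by one fixed functional along |x_n|.
  have hd : Tendsto (fun n => (f n - g) (T (x n))) atTop (𝓝 0) := by
    refine squeeze_zero_norm (fun n => ?_) hk
    have hmono : ∀ z : F, 0 ≤ z → 0 ≤ (f n - g) z := fun z hz => sub_nonneg.2 (hf n z hz).1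
    have hz := abs_le'.1 (abs_apply_le_of_mem_positiveOps hpos (le_refl |x n|))
    have h1 := hmono _ (sub_nonneg.2 hz.1)
    have h2 := hmono _ (sub_nonneg.2 hz.2)
    rw [map_sub] at h1 h2
    rw [map_neg] at h2
    have h3 := (hf n (T |x n|) (hpos _ (abs_nonneg _))).2
    have h4 : (f n - g) (T |x n|) ≤ (k - g) (T |x n|) := sub_le_sub_right h3 _
    exact abs_le'.2 ⟨by linarith, by linarith⟩
  simpa using hd.add hg

end Operators

end BanachLattice

theorem mainTheorem6
    {E : Type*} [NormedAddCommGroup E] [NormedSpace ℝ E] [CompleteSpace E] [Lattice E]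
    [IsOrderedAddMonoid E] [IsOrderedModule ℝ E] [HasSolidNorm E]
    {F : Type*} [NormedAddCommGroup F] [NormedSpace ℝ F] [CompleteSpace F] [Lattice F]
    [IsOrderedAddMonoid F] [IsOrderedModule ℝ F] [HasSolidNorm F] :
    (BanachLattice.aLwc E F ∩ BanachLattice.positiveOps E F ⊆
        BanachLattice.oLwc E F ∩ BanachLattice.positiveOps E F ∧
      BanachLattice.oLwc E F ∩ BanachLattice.positiveOps E F =
        BanachLattice.lLwc E F ∩ BanachLattice.positiveOps E F) ∧
    (BanachLattice.aMwc E F ∩ BanachLattice.positiveOps E F ⊆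
        BanachLattice.oMwc E F ∩ BanachLattice.positiveOps E F ∧
      BanachLattice.oMwc E F ∩ BanachLattice.positiveOps E F ⊆
        BanachLattice.lMwc E F ∩ BanachLattice.positiveOps E F) :=
  ⟨⟨BanachLattice.positive_aLwc_subset_oLwc,
      BanachLattice.positive_oLwc_subset_lLwc.antisymm BanachLattice.positive_lLwc_subset_oLwc⟩,
    BanachLattice.positive_aMwc_subset_oMwc,
    Set.inter_subset_inter_left _ BanachLattice.oMwc_subset_lMwc⟩
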